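/- Let $k$ be a field, $H$ a Hopf algebra over $k$ with comultiplication $\Delta$ and counit $\varepsilon$ (no commutativity, finite-dimensionality, or bijectivity of the antipode is assumed), and let $A$ be a right $H$-comodule algebra, that is, an associative unital $k$-algebra with a right $H$-comodule structure $\rho:A\to A\otimes_k H$ that is a homomorphism of unital algebras. "Ideal" means two-sided ideal. An ideal $I$ of $A$ is called $H$-costable if $\rho(I)\subseteq I\otimes_k H$, and $A$ is called $H$-simple if it has no $H$-costable ideals other than $0$ and $A$. A ring $R$ is called weakly finite if for every $n\ge 1$ and all $X,Y\in\mathrm{Mat}_n(R)$ the equality $XY=1$ implies $YX=1$. Suppose that: - $A$ is semilocal, i.e. the factor ring of $A$ by its Jacobson radical is semisimple Artinian; - (C) for every maximal ideal $Q$ of $A$ the ring $(A/Q)\otimes_k H$ is weakly finite; - there is an ideal $M$ of $A$, minimal among the nonzero $H$-costable ideals of $A$, which is finitely generated as a right $A$-module; - at least one maximal ideal of $A$ contains no nonzero $H$-costable ideal of $A$. Then $A$ is $H$-simple. -/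

import Mathlib

open scoped TensorProduct

/-- A right `H`-comodule algebra over `k`: an algebra `A` with a coassociative and counital
coaction `ρ : A → A ⊗ H` which is a homomorphism of unital algebras. -/
class ComoduleAlgebra (k H A : Type*) [Field k] [Ring H] [HopfAlgebra k H]
    [Ring A] [Algebra k A] where
  /-- the coaction `ρ` -/
  coact : A →ₐ[k] A ⊗[k] H
  /-- `(ρ ⊗ id) ∘ ρ = (id ⊗ Δ) ∘ ρ`, up to the associator -/
  coassoc :
    (TensorProduct.assoc k A H H).toLinearMap ∘ₗ coact.toLinearMap.rTensor H ∘ₗ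
        coact.toLinearMap =
      (Coalgebra.comul (R := k) (A := H)).lTensor A ∘ₗ coact.toLinearMap
  /-- `(id ⊗ ε) ∘ ρ = id`, up to the identification `A ⊗ k = A` -/
  counit_coact :
    (TensorProduct.rid k A).toLinearMap ∘ₗ (Coalgebra.counit (R := k) (A := H)).lTensor A ∘ₗ
        coact.toLinearMap =
      LinearMap.id

section

variable (k H : Type*) {A : Type*} [Field k] [Ring H] [HopfAlgebra k H] [Ring A] [Algebra k A]

/-- The image of `I ⊗ H` in `A ⊗ H`, for a two-sided ideal `I` of `A`. -/
def idealTensor (I : TwoSidedIdeal A) : Submodule k (A ⊗[k] H) :=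
  LinearMap.range ((I.asIdeal.restrictScalars k).subtype.rTensor H)

/-- A two-sided ideal `I` of `A` is `H`-costable if `ρ(I) ⊆ I ⊗ H`. -/
def IsCostable [ComoduleAlgebra k H A] (I : TwoSidedIdeal A) : Prop :=
  ∀ a ∈ I, ComoduleAlgebra.coact (k := k) (H := H) a ∈ idealTensor k H I

variable (A)

/-- `A` is `H`-simple if it has no nonzero proper `H`-costable two-sided ideals. -/
def IsHSimple [ComoduleAlgebra k H A] : Prop :=
  ∀ I : TwoSidedIdeal A, IsCostable k H I → I = ⊥ ∨ I = ⊤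

/-- Condition (C): `A/Q ⊗ H` is weakly (i.e. stably) finite for each maximal two-sided
ideal `Q` of `A`. -/
def ConditionC : Prop :=
  ∀ Q : TwoSidedIdeal A, IsCoatom Q → IsStablyFiniteRing ((A ⧸ Q.asIdeal) ⊗[k] H)

end

/-- A ring is semilocal if its quotient by the Jacobson radical is semisimple Artinian. -/
def IsSemilocal (A : Type*) [Ring A] : Prop :=
  IsSemisimpleRing (A ⧸ Ring.jacobson A)

/-! The aim is to show that a suitable power of `M` is a free right `A`-module and that this forces
`1 ∈ M`. Let `P` be the maximal ideal containing no nonzero costable ideal. Since `P` is prime,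
products of nonzero costable ideals are nonzero, so minimality gives `M = M²`.

Modulo the radical, compare the multiplicity of each simple right module in `M` with its
multiplicity in `A`. For a simple module where the ratio is largest, with annihilator `Q`,
Nakayama's lemma gives `m > 0` generators `v j` of some power `M ^ n` that are free modulo `Q`
(`TwoSidedIdeal.exists_generators_free_mod`).

By the antipode identity, each `v j ⊗ 1` is an `A ⊗ H`-combination of the `ρ(v j)`. Modulo `Q` this
is a matrix equation `X * Y = 1` over `A/Q ⊗ H`, and weak finiteness makes `X` invertible. Applying
`ρ` to a relation `∑ v j * a j = 0` then puts every `a j` in the costable core of `Q`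
(`mem_costableCore_of_relation`).

That core is zero by minimality of `M` and the choice of `P`, so the `v j` form a basis. As `M =
M²`, each `v j` is also a combination of the basis with coefficients in `M`; uniqueness of
coefficients gives `1 ∈ M`. -/

/-- Fibrewise comparison of two finite families gives an injection over the base, which is onto
every fibre where the cardinalities agree. -/
theorem exists_injective_over {α β C : Type*} [Finite α] [Finite β] (a : α → C) (b : β → C)
    (h : ∀ c, Nat.card {x // a x = c} ≤ Nat.card {y // b y = c}) :
    ∃ σ : α → β, Function.Injective σ ∧ (∀ x, b (σ x) = a x) ∧
      ∀ c, Nat.card {x // a x = c} = Nat.card {y // b y = c} → ∀ y, b y = c → ∃ x, σ x = y := by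
  have hex : ∀ c, ∃ f : {x // a x = c} → {y // b y = c}, Function.Injective f := fun c => by
    have := Fintype.ofFinite {x // a x = c}
    have := Fintype.ofFinite {y // b y = c}
    have h' := h c
    rw [Nat.card_eq_fintype_card, Nat.card_eq_fintype_card] at h'
    obtain ⟨f⟩ := Function.Embedding.nonempty_of_card_le h'
    exact ⟨f, f.injective⟩
  choose f hf using hex
  -- `f (a x)` and `f c` have different types; comparing values in `β` avoids transport along `a x =
  -- c`.
  have key : ∀ c (x : {x // a x = c}), (f (a x) ⟨x, rfl⟩ : β) = f c x := by
    rintro c ⟨x, rfl⟩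
    rfl
  refine ⟨fun x => f (a x) ⟨x, rfl⟩, fun x y hxy => ?_, fun x => (f (a x) ⟨x, rfl⟩).2, ?_⟩
  · have hc : a x = a y := by
      rw [← (f (a x) ⟨x, rfl⟩).2, ← (f (a y) ⟨y, rfl⟩).2]
      exact congrArg b hxy
    have h1 := key (a y) ⟨x, hc⟩
    have h2 : f (a y) ⟨x, hc⟩ = f (a y) ⟨y, rfl⟩ := Subtype.ext (h1.symm.trans hxy)
    exact congrArg Subtype.val (hf _ h2)
  · intro c hc y hy
    have hs : Function.Surjective (f c) :=
      ((Nat.bijective_iff_injective_and_card (f c)).2 ⟨hf c, hc⟩).2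
    obtain ⟨x, hx⟩ := hs ⟨y, hy⟩
    exact ⟨x, (key c x).trans (congrArg Subtype.val hx)⟩

/-! ### Simple modules over a ring that is semisimple modulo an ideal -/

section SimpleModules

variable {R : Type*} [Ring R] (J : Ideal R)

/-- A semisimple module is a finite product of simple modules, if it is finitely generated. -/
theorem exists_linearEquiv_pi_simple (X : Type*) [AddCommGroup X] [Module R X]
    [IsSemisimpleModule R X] [Module.Finite R X] :
    ∃ (n : ℕ) (S : Fin n → Submodule R X), Nonempty (X ≃ₗ[R] ∀ i, S i) ∧
      ∀ i, IsSimpleModule R (S i) := by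
  obtain ⟨n, S, e, hS⟩ := IsSemisimpleModule.exists_linearEquiv_fin_dfinsupp R X
  exact ⟨n, S, ⟨e.trans DFinsupp.linearEquivFunOnFintype⟩, hS⟩

/-- The map `R ⧸ J → X` given by the action on an element of a module killed by `J`. -/
def quotientSMulRight {X : Type*} [AddCommGroup X] [Module R X]
    (hX : ∀ r ∈ J, ∀ x : X, r • x = 0) (x : X) : (R ⧸ J) →ₗ[R] X :=
  Submodule.liftQ J (LinearMap.toSpanSingleton R X x) fun r hr => by simpa using hX r hr x

theorem quotientSMulRight_mk {X : Type*} [AddCommGroup X] [Module R X]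
    (hX : ∀ r ∈ J, ∀ x : X, r • x = 0) (x : X) (r : R) :
    quotientSMulRight J hX x (Submodule.Quotient.mk r) = r • x :=
  rfl

/-- Such an `X` is a quotient of a direct sum of copies of `R ⧸ J`, one for each element of `X`. -/
theorem IsSemisimpleModule.of_smul_eq_zero [J.IsTwoSided] [IsSemisimpleModule R (R ⧸ J)] (X : Type*)
    [AddCommGroup X] [Module R X] (hX : ∀ r ∈ J, ∀ x : X, r • x = 0) :
    IsSemisimpleModule R X := by
  classical
  refine IsSemisimpleModule.of_surjective
    (DFinsupp.lsum ℕ fun x : X => quotientSMulRight J hX x) fun x => ?_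
  refine ⟨DFinsupp.single x (Submodule.Quotient.mk 1), ?_⟩
  rw [DFinsupp.lsum_single, quotientSMulRight_mk, one_smul]

/-- If `J` kills a simple module `S` and `R ⧸ J` is a finite product of simple modules `T j`, then
`S` is isomorphic to one of the `T j`. -/
theorem exists_linearEquiv_factor {κ : Type*} [Finite κ] {T : κ → Type*}
    [∀ j, AddCommGroup (T j)] [∀ j, Module R (T j)] [∀ j, IsSimpleModule R (T j)]
    (ψ : (R ⧸ J) ≃ₗ[R] ∀ j, T j) (S : Type*) [AddCommGroup S] [Module R S] [IsSimpleModule R S]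
    (hS : ∀ r ∈ J, ∀ x : S, r • x = 0) : ∃ j, Nonempty (S ≃ₗ[R] T j) := by
  classical
  have := Fintype.ofFinite κ
  have := IsSimpleModule.nontrivial R S
  obtain ⟨s, hs⟩ := exists_ne (0 : S)
  let g : (∀ j, T j) →ₗ[R] S := quotientSMulRight J hS s ∘ₗ ψ.symm.toLinearMap
  by_contra! hne
  apply hs
  -- Schur's lemma: each restriction of `g` to a factor is bijective or zero.
  have hg : g = 0 := by
    refine LinearMap.pi_ext' fun j => ?_
    rcases (g ∘ₗ LinearMap.single R T j).bijective_or_eq_zero with hb | hz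
    · exact ((hne j).false (LinearEquiv.ofBijective _ hb).symm).elim
    · simpa using hz
  have : g (ψ (Submodule.Quotient.mk 1)) = s := by
    simp only [g, LinearMap.comp_apply, LinearEquiv.coe_coe, LinearEquiv.symm_apply_apply,
      quotientSMulRight_mk, one_smul]
  rw [← this, hg, LinearMap.zero_apply]

/-- An element of `R ⧸ J` without components isomorphic to a simple module `S` kills `S`. -/
theorem smul_eq_zero_of_components {κ : Type*} [Finite κ] {T : κ → Type*}
    [∀ j, AddCommGroup (T j)] [∀ j, Module R (T j)] [∀ j, IsSimpleModule R (T j)]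
    (ψ : (R ⧸ J) ≃ₗ[R] ∀ j, T j) (S : Type*) [AddCommGroup S] [Module R S] [IsSimpleModule R S]
    (hS : ∀ r ∈ J, ∀ x : S, r • x = 0) (r : R)
    (hr : ∀ j, Nonempty (T j ≃ₗ[R] S) → ψ (Submodule.Quotient.mk r) j = 0) (s : S) :
    r • s = 0 := by
  classical
  have := Fintype.ofFinite κ
  let g : (∀ j, T j) →ₗ[R] S := quotientSMulRight J hS s ∘ₗ ψ.symm.toLinearMap
  have hg : g (ψ (Submodule.Quotient.mk r)) = r • s := by
    simp only [g, LinearMap.comp_apply, LinearEquiv.coe_coe, LinearEquiv.symm_apply_apply,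
      quotientSMulRight_mk]
  rw [← hg, ← Finset.univ_sum_single (ψ (Submodule.Quotient.mk r)), map_sum]
  refine Finset.sum_eq_zero fun j _ => ?_
  rcases (g ∘ₗ LinearMap.single R T j).bijective_or_eq_zero with hb | hz
  · rw [hr j ⟨LinearEquiv.ofBijective _ hb⟩]
    simp
  · exact LinearMap.congr_fun hz _

/-- The annihilator of a simple module over a semilocal ring is a maximal two-sided ideal. -/
theorem eq_top_of_not_le_annihilator {κ : Type*} [Finite κ] {T : κ → Type*}
    [∀ j, AddCommGroup (T j)] [∀ j, Module R (T j)] [∀ j, IsSimpleModule R (T j)]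
    (ψ : (R ⧸ J) ≃ₗ[R] ∀ j, T j) (S : Type*) [AddCommGroup S] [Module R S] [IsSimpleModule R S]
    (hS : ∀ r ∈ J, ∀ x : S, r • x = 0) (I : Ideal R) [I.IsTwoSided]
    (hle : Module.annihilator R S ≤ I) (hI : ¬ I ≤ Module.annihilator R S) : I = ⊤ := by
  classical
  have := Fintype.ofFinite κ
  have hJ : J ≤ I := fun r hr => hle (Module.mem_annihilator.2 (hS r hr))
  obtain ⟨a, haI, ha⟩ := SetLike.not_le_iff_exists.1 hI
  -- An element concentrated in one component `j` lies in `I`. If `T j ≃ S`, an element `a ∈ I`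
  -- moves some vector of `T j` to a nonzero one, which generates `T j`; otherwise the element kills
  -- `S`. The components of `1` then add up to `1 ∈ I`.
  have hmem : ∀ r, ∀ j, ψ (Submodule.Quotient.mk r) =
      Pi.single j (ψ (Submodule.Quotient.mk r) j) → r ∈ I := by
    intro r j hr
    by_cases hj : Nonempty (T j ≃ₗ[R] S)
    · obtain ⟨e⟩ := hj
      rw [Module.mem_annihilator] at ha
      push Not at ha
      obtain ⟨s, hs⟩ := ha
      have hs' : a • e.symm s ≠ 0 := fun h => hs <| by
        rw [← e.apply_symm_apply s, ← map_smul, h, map_zero]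
      obtain ⟨u, hu⟩ := Submodule.Quotient.mk_surjective J (ψ.symm (Pi.single j (e.symm s)))
      obtain ⟨b, hb⟩ := IsSimpleModule.toSpanSingleton_surjective R hs'
        (ψ (Submodule.Quotient.mk r) j)
      have : Submodule.Quotient.mk (p := J) r = Submodule.Quotient.mk (b * a * u) := by
        apply ψ.injective
        rw [hr, ← smul_eq_mul (b * a), Submodule.Quotient.mk_smul, hu, map_smul,
          LinearEquiv.apply_symm_apply, ← Pi.single_smul, ← hb]
        simp [mul_smul]
      rw [Submodule.Quotient.eq] at this
      rw [← sub_add_cancel r (b * a * u)]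
      exact I.add_mem (hJ this) (I.mul_mem_right _ (I.mul_mem_left _ haI))
    · refine hle (Module.mem_annihilator.2 (smul_eq_zero_of_components J ψ S hS r fun i hi => ?_))
      have hij : i ≠ j := by
        rintro rfl
        exact hj hi
      rw [hr, Pi.single_eq_of_ne hij]
  rw [Ideal.eq_top_iff_one]
  have hlift : ∀ j, ∃ r, Submodule.Quotient.mk (p := J) r =
      ψ.symm (Pi.single j (ψ (Submodule.Quotient.mk 1) j)) := fun j =>
    Submodule.Quotient.mk_surjective J _
  choose r hr using hlift
  have hrI : ∀ j, r j ∈ I := fun j => hmem (r j) j (by rw [hr]; simp)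
  have hsum : Submodule.Quotient.mk (p := J) 1 = Submodule.Quotient.mk (∑ j, r j) := by
    apply ψ.injective
    change _ = ψ (J.mkQ (∑ j, r j))
    rw [map_sum, map_sum]
    simp only [Submodule.mkQ_apply, hr, LinearEquiv.apply_symm_apply]
    exact (Finset.univ_sum_single _).symm
  rw [Submodule.Quotient.eq] at hsum
  rw [← sub_add_cancel 1 (∑ j, r j)]
  exact I.add_mem (hJ hsum) (I.sum_mem fun j _ => hrI j)

end SimpleModules

/-! ### Generators of a power of a module that are free modulo a maximal ideal -/

/-- Two families of elements of a finite set can be compared through a suitable multiple of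
each, with equality at one point. -/
theorem exists_maximal_ratio {ι κ C : Type*} [Finite ι] [Finite κ] [Nonempty ι] (a : ι → C)
    (b : κ → C) (hb : Function.Surjective b) :
    ∃ (n m : ℕ) (c₀ : C), 0 < m ∧
      (∀ c, Nat.card {i // a i = c} * n ≤ Nat.card {j // b j = c} * m) ∧
      Nat.card {i // a i = c₀} * n = Nat.card {j // b j = c₀} * m := by
  have : Finite C := Finite.of_surjective b hb
  have : Nonempty C := ‹Nonempty ι›.map a
  have hpos : ∀ c, 0 < Nat.card {j // b j = c} := fun c => by
    obtain ⟨j, hj⟩ := hb c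
    have : Nonempty {j // b j = c} := ⟨⟨j, hj⟩⟩
    exact Nat.card_pos
  -- The ratio of multiplicities is largest at `c₀`; its denominator and numerator serve as `n` and
  -- `m`.
  obtain ⟨c₀, hc₀⟩ := Finite.exists_max fun c =>
    (Nat.card {i // a i = c} : ℚ) / Nat.card {j // b j = c}
  have hle : ∀ c, Nat.card {i // a i = c} * Nat.card {j // b j = c₀} ≤
      Nat.card {j // b j = c} * Nat.card {i // a i = c₀} := fun c => by
    have h := hc₀ c
    rw [div_le_div_iff₀ (by exact_mod_cast hpos c) (by exact_mod_cast hpos c₀)] at h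
    rw [mul_comm (Nat.card {j // b j = c})]
    exact_mod_cast h
  refine ⟨Nat.card {j // b j = c₀}, Nat.card {i // a i = c₀}, c₀, ?_, hle, mul_comm _ _⟩
  obtain ⟨i⟩ := ‹Nonempty ι›
  have : Nonempty {i' // a i' = a i} := ⟨⟨i, rfl⟩⟩
  have h := hle (a i)
  exact Nat.pos_of_mul_pos_left ((Nat.mul_pos Nat.card_pos (hpos c₀)).trans_le h)

theorem exists_pi_apply_injective {ι κ : Type*} [Finite ι] {T : κ → Type*}
    [∀ j, AddCommMonoid (T j)] {σ : ι → κ} (hσ : Function.Injective σ) (y : ∀ i, T (σ i)) :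
    ∃ t : ∀ j, T j, ∀ i, t (σ i) = y i := by
  classical
  have := Fintype.ofFinite ι
  refine ⟨∑ i, Pi.single (σ i) (y i), fun i => ?_⟩
  rw [Finset.sum_apply, Finset.sum_eq_single i]
  · simp
  · intro i' _ hi'
    exact Pi.single_eq_of_ne (fun h => hi' (hσ h).symm) _
  · simp

section

variable {R : Type*} [Ring R] (J : Ideal R)

/-- Over a semilocal ring with radical `J`, some power of a nonzero finitely generated semisimple
module `X` is a quotient of a free module over `R ⧸ J`, in such a way that the quotient map is
injective on one of the isotypic components. -/
theorem exists_surjective_pi [J.IsTwoSided] [IsSemisimpleModule R (R ⧸ J)] (X : Type*)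
    [AddCommGroup X] [Module R X] [Module.Finite R X] [Nontrivial X]
    (hX : ∀ r ∈ J, ∀ x : X, r • x = 0) :
    ∃ (n m : ℕ) (F : (Fin m → R ⧸ J) →ₗ[R] (Fin n → X)) (Q : Ideal R), 0 < m ∧
      Function.Surjective F ∧ Q.IsTwoSided ∧ Q ≠ ⊤ ∧
      (∀ I : Ideal R, I.IsTwoSided → Q < I → I = ⊤) ∧
      ∀ z : Fin m → R, F (fun l => Submodule.Quotient.mk (z l)) = 0 → ∀ l, z l ∈ Q := by
  classical
  have := IsSemisimpleModule.of_smul_eq_zero J X hX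
  obtain ⟨p, S, ⟨χ⟩, hS⟩ := exists_linearEquiv_pi_simple (R := R) X
  obtain ⟨q, T, ⟨ψ⟩, hT⟩ := exists_linearEquiv_pi_simple (R := R) (R ⧸ J)
  have hJS : ∀ i, ∀ r ∈ J, ∀ x : S i, r • x = 0 := fun i r hr x => Subtype.ext (hX r hr x)
  have hJT : ∀ j, ∀ r ∈ J, ∀ x : T j, r • x = 0 := fun j r hr x => Subtype.ext <| by
    obtain ⟨y, hy⟩ := Submodule.Quotient.mk_surjective J (x : R ⧸ J)
    change r • (x : R ⧸ J) = 0
    rw [← hy, ← Submodule.Quotient.mk_smul, Submodule.Quotient.mk_eq_zero]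
    exact J.mul_mem_right _ hr
  choose t ht using fun i => exists_linearEquiv_factor J ψ (S i) (hJS i)
  -- The classes of `st` are the isomorphism types of simple factors of `R ⧸ J`.
  let st : Setoid (Fin q) :=
    { r := fun j j' => Nonempty (T j ≃ₗ[R] T j')
      iseqv := ⟨fun _ => ⟨.refl _ _⟩, fun ⟨e⟩ => ⟨e.symm⟩, fun ⟨e⟩ ⟨f⟩ => ⟨e.trans f⟩⟩ }
  have : Nonempty (Fin p) := by
    by_contra hne
    rw [not_nonempty_iff] at hne
    obtain ⟨x, hx⟩ := exists_ne (0 : X)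
    exact hx (χ.injective (Subsingleton.elim _ _))
  obtain ⟨n, m, c₀, hm, hle, heq⟩ := exists_maximal_ratio (fun i => (⟦t i⟧ : Quotient st))
    (fun j => (⟦j⟧ : Quotient st)) Quotient.mk_surjective
  have hcard : ∀ {ι : Type} [Finite ι] (f : ι → Quotient st) (d : ℕ) c,
      Nat.card {x : ι × Fin d // f x.1 = c} = Nat.card {i // f i = c} * d := fun f d c => by
    rw [Nat.card_congr (Equiv.prodSubtypeFstEquivSubtypeProd (p := fun i => f i = c)),
      Nat.card_prod, Nat.card_fin]
  obtain ⟨σ, hσ, hσt, hσs⟩ := exists_injective_over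
    (fun x : Fin p × Fin n => (⟦t x.1⟧ : Quotient st))
    (fun y : Fin q × Fin m => (⟦y.1⟧ : Quotient st)) (fun c => by
      rw [hcard (fun i => (⟦t i⟧ : Quotient st)), hcard (fun j => (⟦j⟧ : Quotient st))]
      exact hle c)
  have he : ∀ x, Nonempty (T (σ x).1 ≃ₗ[R] S x.1) := fun x => by
    obtain ⟨e⟩ := Quotient.exact (hσt x)
    obtain ⟨f⟩ := ht x.1
    exact ⟨e.trans f.symm⟩
  let e := fun x => (he x).some
  -- `σ` embeds the simple factors of `X ^ n` among those of `(R ⧸ J) ^ m`, preserving types; `F`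
  -- projects onto the factors it selects. No factor of type `c₀` is lost, so an element of the
  -- kernel has no component of that type.
  let F : (Fin m → R ⧸ J) →ₗ[R] (Fin n → X) := LinearMap.pi fun i' =>
    χ.symm.toLinearMap ∘ₗ LinearMap.pi fun i => (e (i, i')).toLinearMap ∘ₗ
      LinearMap.proj (σ (i, i')).1 ∘ₗ ψ.toLinearMap ∘ₗ LinearMap.proj (σ (i, i')).2
  have hF : ∀ x i' i, χ (F x i') i = e (i, i') (ψ (x (σ (i, i')).2) (σ (i, i')).1) :=
    fun x i' i => by simp [F]
  obtain ⟨j₀, rfl⟩ := Quotient.mk_surjective c₀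
  refine ⟨n, m, F, Module.annihilator R (T j₀), hm, fun y => ?_, inferInstance, ?_, ?_, ?_⟩
  · obtain ⟨s, hs⟩ := exists_pi_apply_injective (T := fun y : Fin q × Fin m => T y.1) hσ
      (fun x => (e x).symm (χ (y x.2) x.1))
    refine ⟨fun l => ψ.symm fun j => s (j, l), funext fun i' => χ.injective (funext fun i => ?_)⟩
    rw [hF, LinearEquiv.apply_symm_apply]
    exact (congrArg (e (i, i')) (hs (i, i'))).trans (LinearEquiv.apply_symm_apply _ _)
  · rw [Ne, Ideal.eq_top_iff_one, Module.mem_annihilator]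
    intro h
    have := IsSimpleModule.nontrivial R (T j₀)
    obtain ⟨s, hs⟩ := exists_ne (0 : T j₀)
    exact hs (by simpa using h s)
  · intro I hI hlt
    exact eq_top_of_not_le_annihilator J ψ (T j₀) (hJT j₀) I hlt.le (not_le_of_gt hlt)
  · intro z hz l
    refine Module.mem_annihilator.2 (smul_eq_zero_of_components J ψ (T j₀) (hJT j₀) (z l) ?_)
    intro j hj
    obtain ⟨x, hx⟩ := hσs ⟦j₀⟧ (by
      rw [hcard (fun i => (⟦t i⟧ : Quotient st)), hcard (fun j => (⟦j⟧ : Quotient st))]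
      exact heq) (j, l) (Quotient.sound hj)
    have h := hF (fun l => Submodule.Quotient.mk (z l)) x.2 x.1
    rw [hz] at h
    have h' := (e x).injective ((map_zero (e x)).trans (by simpa using h))
    have h2 : ∀ y, y = σ x → ψ (Submodule.Quotient.mk (z y.2)) y.1 = 0 := by
      rintro y rfl
      exact h'.symm
    exact h2 _ hx.symm

/-- Let `J` be an ideal contained in the Jacobson radical, with `R ⧸ J` semisimple. Each nonzero
finitely generated `R`-module `N` has a power with a finite generating family which is free modulo
one of the maximal two-sided ideals of `R`. -/
theorem exists_generators_free_mod [J.IsTwoSided] [IsSemisimpleModule R (R ⧸ J)]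
    (hJ : J ≤ Ring.jacobson R) (N : Type*) [AddCommGroup N] [Module R N] [Module.Finite R N]
    [Nontrivial N] :
    ∃ (n m : ℕ) (v : Fin m → Fin n → N) (Q : Ideal R) (φ : (Fin n → N) →ₗ[R] (Fin m → R ⧸ Q)),
      0 < m ∧ Submodule.span R (Set.range v) = ⊤ ∧ Q.IsTwoSided ∧ Q ≠ ⊤ ∧
      (∀ I : Ideal R, I.IsTwoSided → Q < I → I = ⊤) ∧
      ∀ j, φ (v j) = Pi.single j (Submodule.Quotient.mk 1) := by
  classical
  let N₁ : Submodule R N := J • ⊤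
  have hnt : Nontrivial (N ⧸ N₁) := by
    rw [Submodule.Quotient.nontrivial_iff]
    refine ne_of_lt (lt_of_le_of_lt (Submodule.smul_mono_left hJ) ?_)
    exact Submodule.jacobson_smul_lt_top ⊤
  have hkill : ∀ r ∈ J, ∀ x : N ⧸ N₁, r • x = 0 := by
    intro r hr x
    obtain ⟨y, rfl⟩ := Submodule.Quotient.mk_surjective N₁ x
    rw [← Submodule.Quotient.mk_smul, Submodule.Quotient.mk_eq_zero]
    exact Submodule.smul_mem_smul hr trivial
  obtain ⟨n, m, F, Q, hm, hF, hQ, hQt, hmax, hker⟩ := exists_surjective_pi J (N ⧸ N₁) hkill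
  let π : (Fin n → N) →ₗ[R] (Fin n → N ⧸ N₁) := N₁.mkQ.compLeft (Fin n)
  have hπ : Function.Surjective π := N₁.mkQ_surjective.comp_left
  choose v hv using fun j => hπ (F (Pi.single j (Submodule.Quotient.mk 1)))
  let G : (Fin m → R) →ₗ[R] (Fin n → N) := Fintype.linearCombination R v
  have hG : ∀ z, π (G z) = F (fun l => Submodule.Quotient.mk (z l)) := by
    intro z
    rw [Fintype.linearCombination_apply, map_sum]
    conv_rhs => rw [← Finset.univ_sum_single (fun l => (Submodule.Quotient.mk (z l) : R ⧸ J)),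
      map_sum]
    refine Finset.sum_congr rfl fun j _ => ?_
    rw [map_smul, hv, ← map_smul, ← Pi.single_smul, ← Submodule.Quotient.mk_smul, smul_eq_mul,
      mul_one]
  have hrange : LinearMap.range G = Submodule.span R (Set.range v) :=
    Fintype.range_linearCombination R v
  -- Nakayama's lemma for `N ^ n` modulo the span: each `u` differs from some `G z` by a vector with
  -- entries in `J • N`.
  have hspan : Submodule.span R (Set.range v) = ⊤ := by
    by_contra hne
    have := Submodule.Quotient.nontrivial_iff.2 hne
    let W := Submodule.span R (Set.range v)
    refine ((Submodule.smul_mono_left hJ).trans_lt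
      (Submodule.jacobson_smul_lt_top (⊤ : Submodule R ((Fin n → N) ⧸ W)))).ne
      (eq_top_iff.2 fun x _ => ?_)
    obtain ⟨u, rfl⟩ := W.mkQ_surjective x
    obtain ⟨x, hx⟩ := hF (π u)
    obtain ⟨z, rfl⟩ := (Submodule.Quotient.mk_surjective J).comp_left x
    have hπu : π (u - G z) = 0 := by
      rw [map_sub, hG, ← hx]
      exact sub_self _
    have hGz : W.mkQ (G z) = 0 :=
      (Submodule.Quotient.mk_eq_zero W).2 (hrange.le <| LinearMap.mem_range_self G z)
    rw [← sub_add_cancel u (G z), map_add, hGz, add_zero, ← Finset.univ_sum_single (u - G z),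
      map_sum]
    refine Submodule.sum_mem _ fun i _ => ?_
    have hi : (u - G z) i ∈ N₁ := (Submodule.Quotient.mk_eq_zero N₁).1 (congrFun hπu i)
    have := Submodule.mem_map_of_mem (f := W.mkQ ∘ₗ LinearMap.single R (fun _ => N) i) hi
    rw [Submodule.map_smul''] at this
    exact Submodule.smul_mono le_rfl le_top this
  have hGs : Function.Surjective G := LinearMap.range_eq_top.1 (hrange.trans hspan)
  -- Relations between the `v j` have coefficients in `Q`, so reduction modulo `Q` factors through
  -- `G`.
  let μ : (Fin m → R) →ₗ[R] (Fin m → R ⧸ Q) := Q.mkQ.compLeft (Fin m)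
  have hμ : LinearMap.ker G ≤ LinearMap.ker μ := fun z hz => by
    rw [LinearMap.mem_ker] at hz ⊢
    funext l
    exact (Submodule.Quotient.mk_eq_zero Q).2 (hker z (by rw [← hG, hz, map_zero]) l)
  let φ := (LinearMap.ker G).liftQ μ hμ ∘ₗ (G.quotKerEquivOfSurjective hGs).symm.toLinearMap
  have hφ : ∀ z, φ (G z) = μ z := fun z => by
    have : (G.quotKerEquivOfSurjective hGs).symm (G z) = Submodule.Quotient.mk z := by
      rw [LinearEquiv.symm_apply_eq]
      rfl
    simp only [φ, LinearMap.comp_apply, LinearEquiv.coe_coe, this]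
    rfl
  refine ⟨n, m, v, Q, φ, hm, hspan, hQ, hQt, hmax, fun j => ?_⟩
  have : v j = G (Pi.single (M := fun _ => R) j 1) := by simp [G]
  rw [this, hφ]
  funext l
  change Submodule.Quotient.mk (Pi.single (M := fun _ => R) j 1 l) = _
  rcases eq_or_ne l j with rfl | h
  · simp
  · simp [Pi.single_eq_of_ne h]

end

/-! ### Passage to right modules through the opposite ring -/

section Opposite

variable {A : Type*} [Ring A]

/-- A left inverse `u` of `1 - x` equals `1 + u * x`, which again has a left inverse; hence `u` is a
unit. -/
theorem isUnit_one_sub_of_mem_jacobson {x : A} (hx : x ∈ Ring.jacobson A) : IsUnit (1 - x) := by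
  have hleft : ∀ y ∈ Ring.jacobson A, ∃ u, u * (1 - y) = 1 := by
    intro y hy
    have htop : Ideal.span {1 - y} = ⊤ := by
      by_contra hne
      obtain ⟨m, hm, hle⟩ := Ideal.exists_le_maximal _ hne
      refine hm.ne_top ((Ideal.eq_top_iff_one _).2 ?_)
      rw [← sub_add_cancel 1 y]
      exact m.add_mem (hle (Ideal.subset_span rfl)) (Ring.jacobson_le_of_isMaximal m hy)
    exact Ideal.mem_span_singleton'.1 ((Ideal.eq_top_iff_one _).1 htop)
  obtain ⟨u, hu⟩ := hleft x hx
  obtain ⟨w, hw⟩ := hleft (-(u * x)) (neg_mem (Ideal.mul_mem_left _ _ hx))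
  have hu' : 1 - -(u * x) = u := by
    rw [sub_neg_eq_add, ← hu, mul_sub, mul_one, sub_add_cancel]
  rw [hu'] at hw
  have : w = 1 - x := calc
    w = w * (u * (1 - x)) := by rw [hu, mul_one]
    _ = 1 - x := by rw [← mul_assoc, hw, one_mul]
  exact ⟨⟨1 - x, u, this ▸ hw, hu⟩, rfl⟩

instance TwoSidedIdeal.isTwoSided_asIdealOpposite (I : TwoSidedIdeal A) :
    I.asIdealOpposite.IsTwoSided :=
  inferInstanceAs (TwoSidedIdeal.asIdeal _).IsTwoSided

/-- The radical is left-right symmetric because `1 - x * r` is a two-sided unit, while an `x`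
outside a maximal left ideal of `Aᵐᵒᵖ` would make such an element a member of that ideal. -/
theorem asIdealOpposite_jacobson_le :
    (Ring.jacobson A).toTwoSided.asIdealOpposite ≤ Ring.jacobson Aᵐᵒᵖ := by
  refine (le_sInf fun m (hm : m.IsMaximal) x hx => ?_).trans
    (Ring.jacobson_eq_sInf_isMaximal Aᵐᵒᵖ).ge
  rw [TwoSidedIdeal.mem_asIdealOpposite, Ideal.mem_toTwoSided] at hx
  by_contra hxm
  obtain ⟨r, i, hi, hri⟩ := hm.exists_inv hxm
  have hi' : i = 1 - r * x := by
    rw [← hri]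
    abel
  have : IsUnit (1 - x.unop * r.unop) :=
    isUnit_one_sub_of_mem_jacobson (Ideal.mul_mem_right _ _ hx)
  refine hm.ne_top (m.eq_top_of_isUnit_mem hi ?_)
  rw [hi']
  exact this.op

/-- The identification of the quotient of the opposite ring with the quotient of the ring. -/
def quotientOpposite (I : TwoSidedIdeal A) : Aᵐᵒᵖ ⧸ I.asIdealOpposite →+ A ⧸ I.asIdeal :=
  QuotientAddGroup.lift I.asIdealOpposite.toAddSubgroup
    ((Submodule.mkQ I.asIdeal).toAddMonoidHom.comp MulOpposite.opAddEquiv.symm.toAddMonoidHom)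
    fun x hx => (Submodule.Quotient.mk_eq_zero I.asIdeal).2
      (TwoSidedIdeal.mem_asIdealOpposite.1 (show x ∈ I.asIdealOpposite from hx) :)

theorem quotientOpposite_mk (I : TwoSidedIdeal A) (r : Aᵐᵒᵖ) :
    quotientOpposite I (Submodule.Quotient.mk r) = Ideal.Quotient.mk I.asIdeal r.unop :=
  rfl

theorem quotientOpposite_smul (I : TwoSidedIdeal A) (r : Aᵐᵒᵖ) (x : Aᵐᵒᵖ ⧸ I.asIdealOpposite) :
    quotientOpposite I (r • x) = quotientOpposite I x * Ideal.Quotient.mk I.asIdeal r.unop := by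
  obtain ⟨y, rfl⟩ := Submodule.Quotient.mk_surjective _ x
  rw [← Submodule.Quotient.mk_smul, quotientOpposite_mk, quotientOpposite_mk, ← map_mul]
  rfl

theorem quotientOpposite_bijective (I : TwoSidedIdeal A) :
    Function.Bijective (quotientOpposite I) := by
  constructor
  · rw [injective_iff_map_eq_zero]
    intro x hx
    obtain ⟨y, rfl⟩ := Submodule.Quotient.mk_surjective _ x
    rw [quotientOpposite_mk, Ideal.Quotient.eq_zero_iff_mem] at hx
    exact (Submodule.Quotient.mk_eq_zero _).2 (TwoSidedIdeal.mem_asIdealOpposite.2 hx)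
  · intro x
    obtain ⟨y, rfl⟩ := Ideal.Quotient.mk_surjective x
    exact ⟨Submodule.Quotient.mk (MulOpposite.op y), rfl⟩

/-- Semisimplicity of a ring passes to its opposite, and a semilinear bijection carries it to this
module. -/
theorem isSemisimpleModule_quotient_opposite (I : TwoSidedIdeal A)
    [IsSemisimpleRing (A ⧸ I.asIdeal)] :
    IsSemisimpleModule Aᵐᵒᵖ (Aᵐᵒᵖ ⧸ I.asIdealOpposite) := by
  let σ : Aᵐᵒᵖ →+* (A ⧸ I.asIdeal)ᵐᵒᵖ := (Ideal.Quotient.mk I.asIdeal).op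
  have : RingHomSurjective σ := ⟨fun x => by
    obtain ⟨y, hy⟩ := Ideal.Quotient.mk_surjective x.unop
    exact ⟨MulOpposite.op y, MulOpposite.unop_injective hy⟩⟩
  let l : (Aᵐᵒᵖ ⧸ I.asIdealOpposite) →ₛₗ[σ] (A ⧸ I.asIdeal)ᵐᵒᵖ :=
    { toFun := fun x => MulOpposite.op (quotientOpposite I x)
      map_add' := fun x y => by rw [map_add, MulOpposite.op_add]
      map_smul' := fun r x => by
        rw [quotientOpposite_smul, MulOpposite.op_mul]
        rfl }
  rw [l.isSemisimpleModule_iff_of_bijective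
    (MulOpposite.op_bijective.comp (quotientOpposite_bijective I))]
  exact inferInstanceAs (IsSemisimpleRing (A ⧸ I.asIdeal)ᵐᵒᵖ)

theorem TwoSidedIdeal.exists_asIdealOpposite_eq (Q : Ideal Aᵐᵒᵖ) [Q.IsTwoSided] :
    ∃ I : TwoSidedIdeal A, I.asIdealOpposite = Q := by
  refine ⟨Q.toTwoSided.unop, ?_⟩
  ext x
  rw [mem_asIdealOpposite, mem_unop_iff, Ideal.mem_toTwoSided, MulOpposite.op_unop]

end Opposite

/-- A nonzero two-sided ideal `M` of a semilocal algebra, if finitely generated on the right, has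
a power with a finite generating family `v` which is free modulo some maximal ideal `Q`. The
functional `∑ i, φ l i (u i)` gives the `l`-th coordinate of `u` modulo `Q`. -/
theorem TwoSidedIdeal.exists_generators_free_mod (k : Type*) {A : Type*} [Field k] [Ring A]
    [Algebra k A] (hA : IsSemilocal A) (M : TwoSidedIdeal A) (hM : M ≠ ⊥)
    [Module.Finite Aᵐᵒᵖ M] :
    ∃ (n m : ℕ) (v : Fin m → Fin n → A) (Q : TwoSidedIdeal A)
      (φ : Fin m → Fin n → (M.asIdeal.restrictScalars k →ₗ[k] A ⧸ Q.asIdeal)),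
      0 < m ∧ IsCoatom Q ∧ ∃ hv : ∀ j i, v j i ∈ M,
      (∀ u : Fin n → A, (∀ i, u i ∈ M) → ∃ a : Fin m → A, ∀ i, u i = ∑ j, v j i * a j) ∧
      (∀ l i (w : A) (hw : w ∈ M) (a : A), φ l i ⟨w * a, M.mul_mem_right _ _ hw⟩ =
        φ l i ⟨w, hw⟩ * Ideal.Quotient.mk Q.asIdeal a) ∧
      ∀ l j, ∑ i, φ l i ⟨v j i, hv j i⟩ = if l = j then 1 else 0 := by
  classical
  let J := (Ring.jacobson A).toTwoSided
  have : IsSemisimpleRing (A ⧸ J.asIdeal) := by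
    have h : J.asIdeal = Ring.jacobson A := Ideal.asIdeal_toTwoSided _
    have : IsSemisimpleRing (A ⧸ Ring.jacobson A) := hA
    exact (Ideal.quotEquivOfEq h).symm.isSemisimpleRing
  have := isSemisimpleModule_quotient_opposite J
  have : Nontrivial M := by
    by_contra hne
    rw [not_nontrivial_iff_subsingleton] at hne
    refine hM (le_bot_iff.1 fun x hx => ?_)
    exact congrArg Subtype.val (Subsingleton.elim (⟨x, hx⟩ : M) 0)
  obtain ⟨n, m, v, Q₀, φ, hm, hspan, hQ, hQt, hmax, hφ⟩ :=
    _root_.exists_generators_free_mod J.asIdealOpposite asIdealOpposite_jacobson_le M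
  obtain ⟨Q, rfl⟩ := TwoSidedIdeal.exists_asIdealOpposite_eq Q₀
  let f : Fin m → Fin n → M → A ⧸ Q.asIdeal := fun l i w =>
    quotientOpposite Q (φ (Pi.single i w) l)
  have hadd : ∀ l i w w', f l i (w + w') = f l i w + f l i w' := fun l i w w' => by
    simp only [f, Pi.single_add, map_add, Pi.add_apply]
  have hsmul : ∀ l i (r : Aᵐᵒᵖ) w,
      f l i (r • w) = f l i w * Ideal.Quotient.mk Q.asIdeal r.unop := fun l i r w => by
    simp only [f, Pi.single_smul, map_smul, Pi.smul_apply, quotientOpposite_smul]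
  have hcoord : ∀ l u, ∑ i, f l i (u i) = quotientOpposite Q (φ u l) := fun l u => by
    conv_rhs => rw [← Finset.univ_sum_single u, map_sum, Finset.sum_apply, map_sum]
  refine ⟨n, m, fun j i => v j i, Q, fun l i =>
    { toFun := fun w => f l i ⟨w, w.2⟩
      map_add' := fun w w' => hadd l i ⟨w, w.2⟩ ⟨w', w'.2⟩
      map_smul' := fun c w => ?_ }, hm, ?_, fun j i => (v j i).2, ?_, ?_, ?_⟩
  -- Scalars of `k` are central, so right `A`-linearity gives `k`-linearity.
  · have h := hsmul l i (MulOpposite.op (algebraMap k A c)) ⟨w, w.2⟩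
    have hw : MulOpposite.op (algebraMap k A c) • (⟨w, w.2⟩ : M) = ⟨(c • w : _), (c • w).2⟩ :=
      Subtype.ext ((Algebra.commutes c (w : A)).symm.trans (Algebra.smul_def c (w : A)).symm)
    rw [hw] at h
    rw [h, RingHom.id_apply, Algebra.smul_def, MulOpposite.unop_op]
    exact (Algebra.commutes c _).symm
  · refine ⟨?_, fun I hI => ?_⟩
    · rintro rfl
      exact hQt ((Ideal.eq_top_iff_one _).2 (TwoSidedIdeal.mem_asIdealOpposite.2 trivial))
    · have h := hmax I.asIdealOpposite inferInstance ?_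
      · rw [← TwoSidedIdeal.one_mem_iff]
        exact TwoSidedIdeal.mem_asIdealOpposite.1 ((Ideal.eq_top_iff_one _).1 h)
      · refine lt_of_le_not_ge (TwoSidedIdeal.asIdealOpposite.monotone hI.le) fun hle => ?_
        refine hI.not_ge fun x hx => ?_
        exact TwoSidedIdeal.mem_asIdealOpposite.1
          (hle (TwoSidedIdeal.mem_asIdealOpposite.2 (show (MulOpposite.op x).unop ∈ I from hx)))
  · intro u hu
    have hmem : (fun i => (⟨u i, hu i⟩ : M)) ∈ Submodule.span Aᵐᵒᵖ (Set.range v) :=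
      hspan ▸ Submodule.mem_top
    obtain ⟨c, hc⟩ := (Submodule.mem_span_range_iff_exists_fun _).1 hmem
    refine ⟨fun j => (c j).unop, fun i => ?_⟩
    have h := congrArg Subtype.val (congrFun hc i)
    rw [Finset.sum_apply] at h
    refine h.symm.trans ?_
    exact map_sum M.coeAddMonoidHom _ _
  · exact fun l i w hw a => hsmul l i (MulOpposite.op a) ⟨w, hw⟩
  · intro l j
    refine (hcoord l (v j)).trans ?_
    rw [hφ, Pi.single_apply]
    split_ifs
    · rfl
    · exact map_zero _

/-! ### Costable ideals, costable cores and the antipode -/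

section Costable

variable (k H : Type*) {A : Type*} [Field k] [Ring H] [HopfAlgebra k H] [Ring A] [Algebra k A]

/-- The projection `A ⊗ H → A/I ⊗ H`. -/
noncomputable def tensorQuotientMap (I : TwoSidedIdeal A) :
    A ⊗[k] H →ₐ[k] (A ⧸ I.asIdeal) ⊗[k] H :=
  Algebra.TensorProduct.map (Ideal.Quotient.mkₐ k I.asIdeal) (AlgHom.id k H)

theorem tensorQuotientMap_tmul (I : TwoSidedIdeal A) (a : A) (h : H) :
    tensorQuotientMap k H I (a ⊗ₜ h) = Ideal.Quotient.mk I.asIdeal a ⊗ₜ h :=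
  rfl

theorem tensorQuotientMap_eq_rTensor (I : TwoSidedIdeal A) (t : A ⊗[k] H) :
    tensorQuotientMap k H I t = (Ideal.Quotient.mkₐ k I.asIdeal).toLinearMap.rTensor H t :=
  rfl

/-- This is right exactness of tensoring with `H`. -/
theorem mem_idealTensor_iff (I : TwoSidedIdeal A) (t : A ⊗[k] H) :
    t ∈ idealTensor k H I ↔ tensorQuotientMap k H I t = 0 := by
  have hex : Function.Exact (I.asIdeal.restrictScalars k).subtype
      (Ideal.Quotient.mkₐ k I.asIdeal).toLinearMap := fun x => by
    simp [Ideal.Quotient.eq_zero_iff_mem]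
  exact (rTensor_exact H hex (Ideal.Quotient.mkₐ_surjective k I.asIdeal) t).symm

/-- The product of two-sided ideals. -/
def TwoSidedIdeal.product (I J : TwoSidedIdeal A) : TwoSidedIdeal A :=
  (I.asIdeal * J.asIdeal).toTwoSided

theorem TwoSidedIdeal.mul_mem_product {I J : TwoSidedIdeal A} {x y : A} (hx : x ∈ I)
    (hy : y ∈ J) : x * y ∈ I.product J :=
  Ideal.mem_toTwoSided.2 (Ideal.mul_mem_mul hx hy)

theorem TwoSidedIdeal.product_induction {I J : TwoSidedIdeal A} {C : A → Prop} {x : A}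
    (hx : x ∈ I.product J) (hmul : ∀ a ∈ I, ∀ b ∈ J, C (a * b))
    (hadd : ∀ a b, C a → C b → C (a + b)) : C x :=
  Submodule.mul_induction_on (Ideal.mem_toTwoSided.1 hx) hmul hadd

variable {k H} in
theorem mul_mem_idealTensor {I J : TwoSidedIdeal A} {s t : A ⊗[k] H}
    (hs : s ∈ idealTensor k H I) (ht : t ∈ idealTensor k H J) :
    s * t ∈ idealTensor k H (I.product J) := by
  rw [mem_idealTensor_iff]
  obtain ⟨s, rfl⟩ := hs
  obtain ⟨t, rfl⟩ := ht
  induction s with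
  | zero => simp
  | add s s' hs hs' => rw [map_add, add_mul, map_add, hs, hs', add_zero]
  | tmul w h =>
    induction t with
    | zero => simp
    | add t t' ht ht' => rw [map_add, mul_add, map_add, ht, ht', add_zero]
    | tmul w' h' =>
      have : Ideal.Quotient.mk (I.product J).asIdeal ((w : A) * w') = 0 :=
        Ideal.Quotient.eq_zero_iff_mem.2 (TwoSidedIdeal.mul_mem_product w.2 w'.2)
      simp only [LinearMap.rTensor_tmul, Submodule.subtype_apply,
        Algebra.TensorProduct.tmul_mul_tmul, tensorQuotientMap_tmul, this,
        TensorProduct.zero_tmul]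

variable [ComoduleAlgebra k H A]

/-- The algebra homomorphism `A → A/I ⊗ H` induced by the coaction. -/
noncomputable def quotientCoact (I : TwoSidedIdeal A) : A →ₐ[k] (A ⧸ I.asIdeal) ⊗[k] H :=
  (tensorQuotientMap k H I).comp ComoduleAlgebra.coact

variable {k H} in
theorem IsCostable.product {I J : TwoSidedIdeal A} (hI : IsCostable k H I)
    (hJ : IsCostable k H J) : IsCostable k H (I.product J) := fun x hx =>
  TwoSidedIdeal.product_induction
    (C := fun x => ComoduleAlgebra.coact (k := k) (H := H) x ∈ idealTensor k H (I.product J)) hx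
    (fun a ha b hb => by
      rw [map_mul]
      exact mul_mem_idealTensor (hI a ha) (hJ b hb))
    fun a b ha hb => by
      rw [map_add]
      exact add_mem ha hb

theorem coact_coassoc (a : A) :
    (ComoduleAlgebra.coact (k := k) (H := H) (A := A)).toLinearMap.rTensor H
        (ComoduleAlgebra.coact a) =
      (TensorProduct.assoc k A H H).symm
        ((Coalgebra.comul (R := k) (A := H)).lTensor A (ComoduleAlgebra.coact a)) := by
  rw [LinearEquiv.eq_symm_apply]
  exact LinearMap.congr_fun (ComoduleAlgebra.coassoc (k := k) (H := H) (A := A)) a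

theorem lTensor_counit_coact (a : A) :
    (Coalgebra.counit (R := k) (A := H)).lTensor A (ComoduleAlgebra.coact a) = a ⊗ₜ 1 := by
  apply (TensorProduct.rid k A).injective
  rw [TensorProduct.rid_tmul, one_smul]
  exact LinearMap.congr_fun (ComoduleAlgebra.counit_coact (k := k) (H := H) (A := A)) a

/-- The largest `H`-costable ideal contained in `I`. -/
noncomputable def costableCore (I : TwoSidedIdeal A) : TwoSidedIdeal A :=
  TwoSidedIdeal.ker (quotientCoact k H I)

theorem mem_costableCore {I : TwoSidedIdeal A} {a : A} :
    a ∈ costableCore k H I ↔ quotientCoact k H I a = 0 :=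
  TwoSidedIdeal.mem_ker _

/-- Applying the counit to `quotientCoact k H I a` recovers `a` modulo `I`. -/
theorem costableCore_le (I : TwoSidedIdeal A) : costableCore k H I ≤ I := fun a ha => by
  rw [mem_costableCore] at ha
  have hnat : (Coalgebra.counit (R := k) (A := H)).lTensor (A ⧸ I.asIdeal) ∘ₗ
      (Ideal.Quotient.mkₐ k I.asIdeal).toLinearMap.rTensor H =
      (Ideal.Quotient.mkₐ k I.asIdeal).toLinearMap.rTensor k ∘ₗ
        (Coalgebra.counit (R := k) (A := H)).lTensor A := by
    rw [LinearMap.lTensor_comp_rTensor, LinearMap.rTensor_comp_lTensor]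
  have h := LinearMap.congr_fun hnat (ComoduleAlgebra.coact a)
  rw [LinearMap.comp_apply, LinearMap.comp_apply, lTensor_counit_coact,
    ← tensorQuotientMap_eq_rTensor] at h
  change (Coalgebra.counit (R := k) (A := H)).lTensor (A ⧸ I.asIdeal) (quotientCoact k H I a) = _
    at h
  rw [ha, map_zero] at h
  have h' := congrArg (TensorProduct.rid k _) h
  rw [map_zero, LinearMap.rTensor_tmul, TensorProduct.rid_tmul, one_smul] at h'
  exact Ideal.Quotient.eq_zero_iff_mem.1 h'.symm

/-- With `θ` the induced coaction, flatness of `H` reduces the claim to `(θ ⊗ id)(ρ a) = 0`; by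
coassociativity the left side is `(id ⊗ Δ)(θ a)`. -/
theorem isCostable_costableCore (I : TwoSidedIdeal A) :
    IsCostable k H (costableCore k H I) := fun a ha => by
  let θ : A →ₗ[k] (A ⧸ I.asIdeal) ⊗[k] H := (quotientCoact k H I).toLinearMap
  let q : A →ₗ[k] A ⧸ I.asIdeal := (Ideal.Quotient.mkₐ k I.asIdeal).toLinearMap
  have hex : Function.Exact ((costableCore k H I).asIdeal.restrictScalars k).subtype θ :=
    fun x => by
      have := mem_costableCore k H (I := I) (a := x)
      simpa using! this.symm
  refine (Module.Flat.rTensor_exact H hex _).1 ?_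
  have hθ : θ = q.rTensor H ∘ₗ (ComoduleAlgebra.coact (k := k) (H := H)).toLinearMap := rfl
  have hassoc : (q.rTensor H).rTensor H ∘ₗ (TensorProduct.assoc k A H H).symm.toLinearMap =
      (TensorProduct.assoc k (A ⧸ I.asIdeal) H H).symm.toLinearMap ∘ₗ q.rTensor (H ⊗[k] H) := by
    ext a h h'
    simp
  have hcomm : q.rTensor (H ⊗[k] H) ∘ₗ (Coalgebra.comul (R := k) (A := H)).lTensor A =
      (Coalgebra.comul (R := k) (A := H)).lTensor (A ⧸ I.asIdeal) ∘ₗ q.rTensor H := by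
    rw [LinearMap.lTensor_comp_rTensor, LinearMap.rTensor_comp_lTensor]
  rw [hθ, LinearMap.rTensor_comp_apply, coact_coassoc]
  refine (LinearMap.congr_fun hassoc _).trans ?_
  rw [LinearMap.comp_apply]
  refine (congrArg _ (LinearMap.congr_fun hcomm _)).trans ?_
  rw [LinearMap.comp_apply]
  have h0 : q.rTensor H (ComoduleAlgebra.coact a) = 0 := (mem_costableCore k H).1 ha
  rw [h0, map_zero, map_zero]

/-- The map `a ⊗ h ↦ ρ(a) (1 ⊗ S h)`. -/
noncomputable def coactMulAntipode : A ⊗[k] H →ₗ[k] A ⊗[k] H :=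
  LinearMap.mul' k (A ⊗[k] H) ∘ₗ TensorProduct.map
    (ComoduleAlgebra.coact (k := k) (H := H) (A := A)).toLinearMap
    (TensorProduct.mk k A H 1 ∘ₗ HopfAlgebra.antipode k)

theorem coactMulAntipode_tmul (a : A) (h : H) : coactMulAntipode k H (a ⊗ₜ[k] h) =
    ComoduleAlgebra.coact a * (1 ⊗ₜ[k] HopfAlgebra.antipode k h) :=
  rfl

/-- In Sweedler notation, `∑ ρ(a₀) (1 ⊗ S a₁) = ∑ a₀ ⊗ a₁ S(a₂) = a ⊗ 1`. This needs no inverse of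
the antipode. -/
theorem coactMulAntipode_coact (a : A) :
    coactMulAntipode k H (ComoduleAlgebra.coact a) = a ⊗ₜ[k] (1 : H) := by
  let g : H ⊗[k] H →ₗ[k] H := LinearMap.mul' k H ∘ₗ (HopfAlgebra.antipode k).lTensor H
  have hfac : coactMulAntipode k H (A := A) = g.lTensor A ∘ₗ
      (TensorProduct.assoc k A H H).toLinearMap ∘ₗ
        (ComoduleAlgebra.coact (k := k) (H := H) (A := A)).toLinearMap.rTensor H := by
    refine TensorProduct.ext' fun a h => ?_
    rw [coactMulAntipode_tmul]
    simp only [LinearMap.comp_apply, LinearMap.rTensor_tmul, AlgHom.toLinearMap_apply]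
    induction (ComoduleAlgebra.coact a : A ⊗[k] H) with
    | zero => simp
    | add s t hs ht => rw [add_mul, hs, ht, TensorProduct.add_tmul, map_add, map_add]
    | tmul b h' => simp [g]
  have hg : g ∘ₗ Coalgebra.comul (R := k) (A := H) =
      Algebra.linearMap k H ∘ₗ Coalgebra.counit (R := k) (A := H) :=
    HopfAlgebra.mul_antipode_lTensor_comul
  rw [hfac, LinearMap.comp_apply, LinearMap.comp_apply, coact_coassoc, LinearEquiv.coe_coe,
    LinearEquiv.apply_symm_apply, ← LinearMap.lTensor_comp_apply, hg, LinearMap.lTensor_comp_apply,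
    lTensor_counit_coact, LinearMap.lTensor_tmul]
  simp

end Costable

/-! ### Weak finiteness and relations between generators -/

section Relations

variable {k H A : Type*} [Field k] [Ring H] [HopfAlgebra k H] [Ring A] [Algebra k A]

theorem rTensor_subtype_injective (M : TwoSidedIdeal A) :
    Function.Injective ((M.asIdeal.restrictScalars k).subtype.rTensor H) :=
  Module.Flat.rTensor_preserves_injective_linearMap _ (Submodule.subtype_injective _)

/-- Right multiplication by elements of `A ⊗ H` on `M ⊗ H`. -/
theorem exists_rTensor_mul (M Q : TwoSidedIdeal A)
    (t : M.asIdeal.restrictScalars k ⊗[k] H) (s : A ⊗[k] H) :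
    ∃ t' : M.asIdeal.restrictScalars k ⊗[k] H,
      (M.asIdeal.restrictScalars k).subtype.rTensor H t' =
        (M.asIdeal.restrictScalars k).subtype.rTensor H t * s ∧
      ∀ φ : M.asIdeal.restrictScalars k →ₗ[k] A ⧸ Q.asIdeal,
        (∀ (w : A) (hw : w ∈ M) (a : A), φ ⟨w * a, M.mul_mem_right _ _ hw⟩ =
          φ ⟨w, hw⟩ * Ideal.Quotient.mk Q.asIdeal a) →
        φ.rTensor H t' = φ.rTensor H t * tensorQuotientMap k H Q s := by
  induction t with
  | zero => exact ⟨0, by simp, by simp⟩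
  | add t₁ t₂ h₁ h₂ =>
    obtain ⟨t₁', h₁, h₁'⟩ := h₁
    obtain ⟨t₂', h₂, h₂'⟩ := h₂
    refine ⟨t₁' + t₂', by rw [map_add, h₁, h₂, map_add, add_mul], fun φ hφ => ?_⟩
    rw [map_add, h₁' φ hφ, h₂' φ hφ, map_add, add_mul]
  | tmul w h =>
    induction s with
    | zero => exact ⟨0, by simp, by simp⟩
    | add t₁ t₂ h₁ h₂ =>
      obtain ⟨t₁', h₁, h₁'⟩ := h₁
      obtain ⟨t₂', h₂, h₂'⟩ := h₂
      refine ⟨t₁' + t₂', by rw [map_add, h₁, h₂, mul_add], fun φ hφ => ?_⟩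
      rw [map_add, h₁' φ hφ, h₂' φ hφ, map_add, mul_add]
    | tmul a h' =>
      refine ⟨(⟨w * a, M.mul_mem_right _ _ w.2⟩ : M.asIdeal.restrictScalars k) ⊗ₜ (h * h'),
        ?_, fun φ hφ => ?_⟩
      · simp
      · simp only [LinearMap.rTensor_tmul, tensorQuotientMap_tmul,
          Algebra.TensorProduct.tmul_mul_tmul]
        rw [hφ w w.2 a]

variable [ComoduleAlgebra k H A]

/-- If `v` generates the right module `M ^ n` for a costable ideal `M`, then the elements `ρ(v j)`
generate the right `A ⊗ H`-module `(M ⊗ H) ^ n`. -/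
theorem exists_sum_coact_mul_eq_tmul_one {n m : ℕ} (M : TwoSidedIdeal A) (hM : IsCostable k H M)
    (v : Fin m → Fin n → A)
    (hspan : ∀ u : Fin n → A, (∀ i, u i ∈ M) → ∃ a : Fin m → A, ∀ i, u i = ∑ j, v j i * a j)
    (u : Fin n → A) (hu : ∀ i, u i ∈ M) :
    ∃ y : Fin m → A ⊗[k] H, ∀ i, ∑ j, ComoduleAlgebra.coact (v j i) * y j = u i ⊗ₜ 1 := by
  have hsingle : ∀ (i₀ : Fin n) (t : M.asIdeal.restrictScalars k ⊗[k] H),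
      ∃ y : Fin m → A ⊗[k] H, ∀ i, ∑ j, ComoduleAlgebra.coact (v j i) * y j =
        if i = i₀ then
          coactMulAntipode k H ((M.asIdeal.restrictScalars k).subtype.rTensor H t) else 0 := by
    intro i₀ t
    induction t with
    | zero => exact ⟨0, by simp⟩
    | add t₁ t₂ h₁ h₂ =>
      obtain ⟨y₁, h₁⟩ := h₁
      obtain ⟨y₂, h₂⟩ := h₂
      refine ⟨y₁ + y₂, fun i => ?_⟩
      simp only [Pi.add_apply, mul_add, Finset.sum_add_distrib, h₁, h₂, map_add]
      split_ifs <;> simp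
    | tmul w h =>
      obtain ⟨a, ha⟩ := hspan (fun i => if i = i₀ then (w : A) else 0) fun i => by
        split_ifs
        exacts [w.2, M.zero_mem]
      refine ⟨fun j => ComoduleAlgebra.coact (a j) * (1 ⊗ₜ HopfAlgebra.antipode k h),
        fun i => ?_⟩
      simp only [← mul_assoc, ← map_mul, ← Finset.sum_mul, ← map_sum, ← ha]
      split_ifs
      · rfl
      · rw [map_zero, zero_mul]
  choose t ht using fun i => hM (u i) (hu i)
  choose y hy using fun i₀ => hsingle i₀ (t i₀)
  refine ⟨fun j => ∑ i₀, y i₀ j, fun i => ?_⟩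
  simp only [Finset.mul_sum]
  rw [Finset.sum_comm]
  simp only [hy, ht, coactMulAntipode_coact]
  simp

/-- Weak finiteness of `A/Q ⊗ H` forces the relations between generators of `M ^ n` which are free
modulo `Q` to have their coefficients in the costable core of `Q`. -/
theorem mem_costableCore_of_relation {n m : ℕ} (M Q : TwoSidedIdeal A) (hM : IsCostable k H M)
    [IsStablyFiniteRing ((A ⧸ Q.asIdeal) ⊗[k] H)]
    (v : Fin m → Fin n → A)
    (φ : Fin m → Fin n → (M.asIdeal.restrictScalars k →ₗ[k] A ⧸ Q.asIdeal))
    (hv : ∀ j i, v j i ∈ M)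
    (hspan : ∀ u : Fin n → A, (∀ i, u i ∈ M) → ∃ a : Fin m → A, ∀ i, u i = ∑ j, v j i * a j)
    (hmul : ∀ l i (w : A) (hw : w ∈ M) (a : A), φ l i ⟨w * a, M.mul_mem_right _ _ hw⟩ =
        φ l i ⟨w, hw⟩ * Ideal.Quotient.mk Q.asIdeal a)
    (hφ : ∀ l j, ∑ i, φ l i ⟨v j i, hv j i⟩ = if l = j then 1 else 0)
    (a : Fin m → A) (ha : ∀ i, ∑ j, v j i * a j = 0) (j : Fin m) :
    a j ∈ costableCore k H Q := by
  choose t ht using fun j i => hM (v j i) (hv j i)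
  -- Column `j` of `X` lists the coordinates of `ρ(v j)` modulo `Q`.
  let X : Matrix (Fin m) (Fin m) ((A ⧸ Q.asIdeal) ⊗[k] H) :=
    Matrix.of fun l j => ∑ i, (φ l i).rTensor H (t j i)
  have hX : ∀ (s : Fin m → A ⊗[k] H) (u : Fin n → M.asIdeal.restrictScalars k ⊗[k] H),
      (∀ i, ∑ j, ComoduleAlgebra.coact (v j i) * s j =
        (M.asIdeal.restrictScalars k).subtype.rTensor H (u i)) →
      ∀ l, ∑ j, X l j * tensorQuotientMap k H Q (s j) = ∑ i, (φ l i).rTensor H (u i) := by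
    intro s u hu l
    choose t' ht' hφt' using fun j i => exists_rTensor_mul M Q (t j i) (s j)
    have hsum : ∀ i, u i = ∑ j, t' j i := fun i => by
      apply rTensor_subtype_injective M
      rw [← hu, map_sum]
      exact Finset.sum_congr rfl fun j _ => by rw [ht', ht]
    simp only [hsum, map_sum, X, Matrix.of_apply, Finset.sum_mul]
    rw [Finset.sum_comm]
    exact Finset.sum_congr rfl fun i _ => Finset.sum_congr rfl fun j _ =>
      (hφt' j i _ (hmul l i)).symm
  choose y hy using fun j => exists_sum_coact_mul_eq_tmul_one M hM v hspan (v j) (hv j)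
  let Y : Matrix (Fin m) (Fin m) ((A ⧸ Q.asIdeal) ⊗[k] H) :=
    Matrix.of fun j l => tensorQuotientMap k H Q (y l j)
  -- The combinations given by `y j` equal `v j ⊗ 1`, whose coordinates are those of a unit vector.
  have hXY : X * Y = 1 := by
    ext l j
    rw [Matrix.mul_apply, Matrix.one_apply]
    refine (hX (y j) (fun i => ⟨v j i, hv j i⟩ ⊗ₜ 1) (fun i => by simp [hy]) l).trans ?_
    simp only [LinearMap.rTensor_tmul]
    rw [← TensorProduct.sum_tmul, hφ]
    split_ifs
    · rfl
    · exact TensorProduct.zero_tmul _ _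
  have hYX : Y * X = 1 := mul_eq_one_symm hXY
  have hXa : X.mulVec (fun j => quotientCoact k H Q (a j)) = 0 := by
    ext l
    refine (hX (fun j => ComoduleAlgebra.coact (a j)) (fun _ => 0) (fun i => ?_) l).trans ?_
    · simp only [← map_mul, ← map_sum, ha, map_zero]
    · simp
  have h := congrArg Y.mulVec hXa
  rw [Matrix.mulVec_mulVec, hYX, Matrix.one_mulVec, Matrix.mulVec_zero] at h
  exact (mem_costableCore k H).2 (congrFun h j)

end Relations

/-! ### Products of ideals and the conclusion -/

/-- Maximal ideals are prime: `1 = p + x` and `1 = p' + y` give `1 = p + x * p' + x * y`. -/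
theorem TwoSidedIdeal.le_or_le_of_product_le {A : Type*} [Ring A] {P I J : TwoSidedIdeal A}
    (hP : IsCoatom P) (h : I.product J ≤ P) : I ≤ P ∨ J ≤ P := by
  by_contra! hne
  have hone : ∀ K : TwoSidedIdeal A, ¬ K ≤ P → ∃ p ∈ P, ∃ x ∈ K, p + x = 1 := fun K hK => by
    have : P ⊔ K = ⊤ := hP.2 _ (left_lt_sup.2 hK)
    exact TwoSidedIdeal.mem_sup.1 (this ▸ trivial : (1 : A) ∈ P ⊔ K)
  obtain ⟨p, hp, x, hx, hpx⟩ := hone I hne.1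
  obtain ⟨p', hp', y, hy, hpy⟩ := hone J hne.2
  refine hP.1 (TwoSidedIdeal.one_mem_iff P |>.1 ?_)
  have : (1 : A) = p + x * p' + x * y := by
    rw [add_assoc, ← mul_add, hpy, mul_one, hpx]
  rw [this]
  exact P.add_mem (P.add_mem hp (P.mul_mem_left _ _ hp')) (h (mul_mem_product hx hy))

theorem TwoSidedIdeal.product_le_left {A : Type*} [Ring A] (I J : TwoSidedIdeal A) :
    I.product J ≤ I := fun _ hx =>
  product_induction hx (fun _ ha _ _ => I.mul_mem_right _ _ ha) fun _ _ => I.add_mem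

theorem TwoSidedIdeal.product_le_right {A : Type*} [Ring A] (I J : TwoSidedIdeal A) :
    I.product J ≤ J := fun _ hx =>
  product_induction hx (fun _ _ _ hb => J.mul_mem_left _ _ hb) fun _ _ => J.add_mem

theorem proposition3p7 {k H A : Type*} [Field k] [Ring H] [HopfAlgebra k H]
    [Ring A] [Algebra k A] [ComoduleAlgebra k H A]
    (hsemi : IsSemilocal A) (hC : ConditionC k H A)
    (hmin : ∃ M : TwoSidedIdeal A,
      Minimal (fun I : TwoSidedIdeal A => IsCostable k H I ∧ I ≠ ⊥) M ∧
        Module.Finite Aᵐᵒᵖ M)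
    (hmax : ∃ P : TwoSidedIdeal A, IsCoatom P ∧
      ∀ I : TwoSidedIdeal A, IsCostable k H I → I ≤ P → I = ⊥) :
    IsHSimple k H A := by
  obtain ⟨M, hMmin, hMfin⟩ := hmin
  obtain ⟨P, hP, hPI⟩ := hmax
  have hMc : IsCostable k H M := hMmin.prop.1
  have hM0 : M ≠ ⊥ := hMmin.prop.2
  have hMP : ¬ M ≤ P := fun h => hM0 (hPI M hMc h)
  suffices hMtop : M = ⊤ by
    intro I hI
    by_cases hI0 : I = ⊥
    · exact Or.inl hI0
    · exact Or.inr (top_le_iff.1 (hMtop ▸ hMmin.le_of_le ⟨hI, hI0⟩ (hMtop ▸ le_top)))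
  have hMM : M ≤ M.product M := by
    refine hMmin.le_of_le ⟨hMc.product hMc, fun h => ?_⟩ (TwoSidedIdeal.product_le_left M M)
    rcases TwoSidedIdeal.le_or_le_of_product_le hP (h.trans_le bot_le) with h | h <;>
      exact hMP h
  obtain ⟨n, m, v, Q, φ, hm, hQ, hv, hspan, hmul, hφ⟩ :=
    TwoSidedIdeal.exists_generators_free_mod k hsemi M hM0
  have : Nontrivial (A ⧸ Q.asIdeal) := Ideal.Quotient.nontrivial_iff.2 fun h =>
    hQ.1 (Q.one_mem_iff.1 ((Ideal.eq_top_iff_one _).1 h))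
  -- If `M ≤ Q`, the coordinates modulo `Q` vanish on `M * M = M`, contradicting freeness since `m >
  -- 0`.
  have hMQ : ¬ M ≤ Q := by
    intro hle
    have hφ0 : ∀ l i (w : M.asIdeal.restrictScalars k), φ l i w = 0 := by
      rintro l i ⟨w, hw⟩
      have hw' : ∃ hw : w ∈ M, φ l i ⟨w, hw⟩ = 0 := by
        refine TwoSidedIdeal.product_induction
          (C := fun w => ∃ hw : w ∈ M, φ l i ⟨w, hw⟩ = 0) (hMM hw) (fun a ha b hb => ?_) ?_
        · refine ⟨M.mul_mem_right _ _ ha, ?_⟩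
          rw [hmul l i a ha b, Ideal.Quotient.eq_zero_iff_mem.2 (hle hb), mul_zero]
        · rintro a b ⟨ha, ha'⟩ ⟨hb, hb'⟩
          refine ⟨M.add_mem ha hb, ?_⟩
          rw [← add_zero (0 : A ⧸ Q.asIdeal)]
          nth_rw 1 [← ha']
          rw [← hb', ← map_add]
          rfl
      exact hw'.2
    have := hφ ⟨0, hm⟩ ⟨0, hm⟩
    simp [hφ0] at this
  have hcore : costableCore k H Q = ⊥ := by
    refine hPI _ (isCostable_costableCore k H Q) ?_
    refine (TwoSidedIdeal.le_or_le_of_product_le (J := M) hP ?_).resolve_right hMP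
    -- If `core * M` were nonzero, minimality would give `M ≤ core * M ≤ core ≤ Q`.
    by_contra hne
    have h0 : (costableCore k H Q).product M ≠ ⊥ := fun h => hne (h.trans_le bot_le)
    refine hMQ ((hMmin.le_of_le ⟨(isCostable_costableCore k H Q).product hMc, h0⟩
      (TwoSidedIdeal.product_le_right _ M)).trans ?_)
    exact (TwoSidedIdeal.product_le_left _ M).trans (costableCore_le k H Q)
  have hfree : ∀ a : Fin m → A, (∀ i, ∑ j, v j i * a j = 0) → a = 0 := by
    intro a ha
    have := hC Q hQ
    funext j
    have := mem_costableCore_of_relation M Q hMc v φ hv hspan hmul hφ a ha j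
    rwa [hcore] at this
  have hspanM : ∀ (i₀ : Fin n) (w : A), w ∈ M →
      ∃ b : Fin m → A, (∀ j, b j ∈ M) ∧ ∀ i, (if i = i₀ then w else 0) = ∑ j, v j i * b j := by
    intro i₀ w hw
    refine TwoSidedIdeal.product_induction
      (C := fun w => ∃ b : Fin m → A, (∀ j, b j ∈ M) ∧
        ∀ i, (if i = i₀ then w else 0) = ∑ j, v j i * b j) (hMM hw) (fun x hx y hy => ?_) ?_
    · obtain ⟨a, ha⟩ := hspan (fun i => if i = i₀ then x else 0) fun i => by
        split_ifs
        exacts [hx, M.zero_mem]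
      refine ⟨fun j => a j * y, fun j => M.mul_mem_left _ _ hy, fun i => ?_⟩
      simp only [← mul_assoc, ← Finset.sum_mul, ← ha, ite_mul, zero_mul]
    · rintro x y ⟨b, hb, hbx⟩ ⟨c, hc, hcy⟩
      refine ⟨b + c, fun j => M.add_mem (hb j) (hc j), fun i => ?_⟩
      simp only [Pi.add_apply, mul_add, Finset.sum_add_distrib, ← hbx, ← hcy]
      split_ifs <;> simp
  let j₀ : Fin m := ⟨0, hm⟩
  choose b hbM hb using fun i₀ => hspanM i₀ (v j₀ i₀) (hv j₀ i₀)
  -- Two expressions of `v j₀` are compared: coefficients in `M`, summed over the places `i₀`, and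
  -- the unit vector at `j₀`.
  have hrel := hfree ((∑ i₀, b i₀) - Pi.single j₀ 1) fun i => by
    simp only [Pi.sub_apply, mul_sub, Finset.sum_sub_distrib, Finset.sum_apply, Finset.mul_sum]
    rw [Finset.sum_comm]
    simp only [← hb]
    simp [Pi.single_apply]
  have hone := congrFun hrel j₀
  rw [Pi.sub_apply, Pi.single_eq_same, Finset.sum_apply, Pi.zero_apply, sub_eq_zero] at hone
  rw [← TwoSidedIdeal.one_mem_iff, ← hone]
  exact sum_mem fun i _ => hbM i j₀
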